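/- Let $M,L\ge 1$, let $E_1,\dots,E_L$ be non-empty sets of directed edges (clusters) in $[M]\times[M]$, $R_i=|E_i|$, and let $\mathcal I=(\mathcal I_{e,e'})_{e,e'\in[M]\times[M]}$ be the Fisher information of the network at the pre-change parameter, with positive definite blocks $\mathcal I^{(i)}=(\mathcal I_{e,e'})_{e,e'\in E_i}$. Under the null hypothesis $H_0$ (no change) the score process is modelled by its Gaussian approximation: $(S_t^{e})_{t\in\mathbb R,\,e\in[M]\times[M]}$ is a centred Gaussian process with $\operatorname{Cov}(S_s^{e},S_t^{e'})=\tfrac12(|s|+|t|-|s-t|)\,\mathcal I_{e,e'}$ (that is, $\min(s,t)\,\mathcal I_{e,e'}$ for $s,t\ge 0$). For a window length $w$ and an update interval $\delta$, $0<\delta\le w$, put $$\Gamma^{(i)}_{t,w}=(wR_i)^{-1/2}\,\mathbf 1^\top(\mathcal I^{(i)})^{-1/2}\,(S^{e}_t-S^{e}_{t-w})_{e\in E_i},\qquad \Gamma_t=\max_{1\le i\le L}|\Gamma^{(i)}_{t,w}|,$$ so that each $\Gamma^{(i)}_{t,w}$ is standard normal and $\operatorname{Cov}(\Gamma^{(i)}_{t,w},\Gamma^{(j)}_{t+\epsilon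 w,w})=(1-\epsilon)^+\operatorname{Cov}(\Gamma^{(i)}_{t,w},\Gamma^{(j)}_{t,w})$ for $\epsilon\ge0$. For a threshold $b$ let $$T_b=\inf\{t\in\{\delta,2\delta,3\delta,\dots\}:\Gamma_t>b\}\in(0,\infty],\qquad f(b)=b\,e^{b^2/2}.$$ Let $w$, $\delta$ and the positive integer $m$ be allowed to depend on $b$, with $w/\delta\ll m\ll f(b)$, i.e. $(w/\delta)/m\to0$ and $m/f(b)\to0$ as $b\to\infty$. Fix $x\ge 0$, put $k=\lfloor x f(b)/m\rfloor$, and let $$W=\sum_{j=1}^{k}X_j,\qquad X_j=\mathbb I\Big\{\max_{(j-1)m<n\le jm}\Gamma_{n\delta}>b\Big\}.$$ Then $$\lim_{b\to\infty}\Big|\mathbb P\big(T_b>x f(b)\,\delta\big)-e^{-\mathbb E W}\Big|=0 .$$ -/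

import Mathlib

open MeasureTheory ProbabilityTheory Filter Topology

namespace HawkesScan

noncomputable section

/-- An edge `(p, q)` of the network on `M` nodes (the influence of node `p` on node `q`). -/
abbrev Edge (M : ℕ) : Type := Fin M × Fin M

variable {Ω : Type*} [MeasurableSpace Ω] {M L : ℕ}

/-- The score process under the null hypothesis, in the Gaussian process approximation: the
`M²`-dimensional process `S` is a centred (two-sided) Gaussian process with stationary independent
increments and covariance `I` per unit of time, where `I` is the Fisher information at the
pre-change parameter. For `0 ≤ s, t` the factor `(|s| + |t| - |s - t|) / 2` is `min s t`; hence
increments of `S` over two time intervals have covariance `I` times the length of the overlap of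
the intervals. Negative times serve the windows `[t - w, t]` with `t < w`. -/
structure IsNullScore (S : ℝ → Edge M → Ω → ℝ) (I : Matrix (Edge M) (Edge M) ℝ)
    (P : Measure Ω) : Prop where
  gaussian : IsGaussianProcess (fun (a : ℝ × Edge M) (ω : Ω) => S a.1 a.2 ω) P
  mean_zero : ∀ t e, ∫ ω, S t e ω ∂P = 0
  covariance : ∀ s t e e',
    cov[S s e, S t e'; P] = (|s| + |t| - |s - t|) / 2 * I e e'

/-- The Fisher information of the edges of one cluster. -/
def clusterInfo (I : Matrix (Edge M) (Edge M) ℝ) (E : Finset (Edge M)) : Matrix E E ℝ :=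
  I.submatrix Subtype.val Subtype.val

/-- `A ^ (-1/2)` for a positive definite matrix `A`, by the functional calculus. -/
def invSqrt {n : Type*} [Fintype n] [DecidableEq n] (A : Matrix n n ℝ) : Matrix n n ℝ :=
  cfc (fun x : ℝ => (√x)⁻¹) A

/-- `S_{t,w} = (S_t^{(p,q)} - S_{t-w}^{(p,q)})`, `(p,q)` in the cluster `E`. -/
def windowScore (S : ℝ → Edge M → Ω → ℝ) (E : Finset (Edge M)) (w t : ℝ) (ω : Ω) : E → ℝ :=
  fun e => S t e ω - S (t - w) e ω

/-- The statistic of the cluster `E`,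
`Γ_{t,w} = (w R)^{-1/2} 1ᵀ I_E^{-1/2} S_{t,w}` with `R` the number of edges of `E`. -/
def clusterStat (S : ℝ → Edge M → Ω → ℝ) (I : Matrix (Edge M) (Edge M) ℝ)
    (E : Finset (Edge M)) (w t : ℝ) (ω : Ω) : ℝ :=
  (√(w * (E.card : ℝ)))⁻¹ *
    ((fun _ => 1) ⬝ᵥ Matrix.mulVec (invSqrt (clusterInfo I E)) (windowScore S E w t ω))

/-- The scan statistic `Γ_t = max_{1 ≤ i ≤ L} |Γ_{t,w}^{(i)}|`. -/
def scanStat (S : ℝ → Edge M → Ω → ℝ) (I : Matrix (Edge M) (Edge M) ℝ)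
    (E : Fin L → Finset (Edge M)) (w t : ℝ) (ω : Ω) : ℝ :=
  ⨆ i : Fin L, |clusterStat S I (E i) w t ω|

/-- `T_b = inf {t : Γ_t > b}`, where `t` runs through the update times `δ, 2δ, 3δ, …`;
the value is `⊤` if there is no alarm. -/
def stopTime (S : ℝ → Edge M → Ω → ℝ) (I : Matrix (Edge M) (Edge M) ℝ)
    (E : Fin L → Finset (Edge M)) (w δ b : ℝ) (ω : Ω) : EReal :=
  sInf {T : EReal | ∃ n : ℕ, 1 ≤ n ∧ b < scanStat S I E w (n * δ) ω ∧ T = ((n * δ : ℝ) : EReal)}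

/-- The event that `Γ_{nδ} > b` for some `n` of the `j`-th block `(j-1)m < n ≤ jm`, `j ≥ 1`. -/
def blockEvent (S : ℝ → Edge M → Ω → ℝ) (I : Matrix (Edge M) (Edge M) ℝ)
    (E : Fin L → Finset (Edge M)) (w δ b : ℝ) (m j : ℕ) : Set Ω :=
  {ω | ∃ n ∈ Finset.Ioc ((j - 1) * m) (j * m), b < scanStat S I E w (n * δ) ω}

/-- `W = X_1 + ⋯ + X_k`, with `X_j` the indicator of the `j`-th block event. -/
def blockCount (S : ℝ → Edge M → Ω → ℝ) (I : Matrix (Edge M) (Edge M) ℝ)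
    (E : Fin L → Finset (Edge M)) (w δ b : ℝ) (m k : ℕ) (ω : Ω) : ℝ :=
  ∑ j ∈ Finset.Icc 1 k, (blockEvent S I E w δ b m j).indicator (fun _ => (1 : ℝ)) ω

/-- `f(b) = b e^{b²/2}`. -/
def runScale (b : ℝ) : ℝ := b * Real.exp (b ^ 2 / 2)

end

end HawkesScan

/-! No alarm up to time `x f(b) δ` means that none of the first `⌊x f(b)⌋` statistics exceeds `b`.
One statistic does so with probability at most `p = 2L / f(b)`, by the Gaussian tail and a union
bound over clusters. Only this upper bound is needed, since the blocks themselves supply the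
exponent `𝔼 W`.

Remove the first `q = ⌈w/δ⌉` indices of each of the `k` blocks. Windows from different trimmed
blocks are then disjoint, so the statistics are uncorrelated and, being jointly Gaussian, exactly
independent (`measureReal_iInter_block_compl`). The probability of no exceedance becomes a product
of factors `1 - p_j`, which is compared with `exp (-∑ p_j)` (`abs_measureReal_compl_sub_exp_le`).
The errors are `k (m p)²` from this comparison, `k q p` twice from trimming, and `m p` from the
incomplete last block. As `k ≤ x f(b) / m`, they are of order `m / f(b)` and `(w/δ) / m`. -/

namespace HawkesScan

/-! ### Gaussian tail bound -/

/-- The tail of the standard normal law, compared with the scale `b * exp (b ^ 2 / 2)`. -/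
lemma gaussianReal_real_Ioi_le {b : ℝ} (hb : 0 < b) :
    (gaussianReal 0 1).real (Set.Ioi b) ≤ 1 / runScale b := by
  have hderiv : ∀ x ∈ Set.Ici b,
      HasDerivAt (fun x : ℝ => -(b⁻¹ * Real.exp (-x ^ 2 / 2)))
        (b⁻¹ * (x * Real.exp (-x ^ 2 / 2))) x := by
    intro x _
    have h : HasDerivAt (fun x : ℝ => -x ^ 2 / 2) (-x) x := by
      have := ((hasDerivAt_pow 2 x).neg.div_const 2)
      convert! this using 1
      simp only [Nat.cast_ofNat, Nat.add_one_sub_one, pow_one]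
      ring
    convert! (h.exp.const_mul b⁻¹).neg using 1
    ring
  have hlim : Tendsto (fun x : ℝ => -(b⁻¹ * Real.exp (-x ^ 2 / 2))) atTop (𝓝 0) := by
    have h1 : Tendsto (fun x : ℝ => -x ^ 2 / 2) atTop atBot := by
      have h2 : Tendsto (fun x : ℝ => x ^ 2 / 2) atTop atTop :=
        (tendsto_pow_atTop two_ne_zero).atTop_div_const two_pos
      refine (tendsto_neg_atTop_atBot.comp h2).congr fun x => ?_
      simp [neg_div]
    simpa using ((Real.tendsto_exp_atBot.comp h1).const_mul b⁻¹).neg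
  have hpos : ∀ x ∈ Set.Ioi b, 0 ≤ b⁻¹ * (x * Real.exp (-x ^ 2 / 2)) := by
    intro x hx
    have : 0 < x := hb.trans hx
    positivity
  have hint := integrableOn_Ioi_deriv_of_nonneg' hderiv hpos hlim
  have hval := integral_Ioi_of_hasDerivAt_of_nonneg' hderiv hpos hlim
  have hpdf : (gaussianReal 0 1).real (Set.Ioi b) = ∫ x in Set.Ioi b, gaussianPDFReal 0 1 x := by
    rw [Measure.real, gaussianReal_apply_eq_integral _ one_ne_zero, ENNReal.toReal_ofReal]
    exact integral_nonneg fun x => gaussianPDFReal_nonneg _ _ _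
  rw [hpdf]
  calc ∫ x in Set.Ioi b, gaussianPDFReal 0 1 x
      ≤ ∫ x in Set.Ioi b, b⁻¹ * (x * Real.exp (-x ^ 2 / 2)) := by
        refine setIntegral_mono_on (integrable_gaussianPDFReal 0 1).integrableOn hint
          measurableSet_Ioi fun x hx => ?_
        have hx' : b < x := hx
        -- The density is enlarged by the factor `x / b ≥ 1`, which makes it an exact derivative;
        -- the constant `(2π)^{-1/2}` is simply dropped.
        have h1 : (√(2 * Real.pi * 1))⁻¹ ≤ 1 := by
          apply inv_le_one_of_one_le₀
          rw [Real.one_le_sqrt]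
          nlinarith [Real.pi_gt_three]
        have h2 : 1 ≤ b⁻¹ * x := by
          rw [inv_mul_eq_div, one_le_div hb]
          exact hx'.le
        have h3 : gaussianPDFReal 0 1 x = (√(2 * Real.pi * 1))⁻¹ * Real.exp (-x ^ 2 / 2) := by
          simp [gaussianPDFReal]
        rw [h3, ← mul_assoc]
        exact mul_le_mul_of_nonneg_right (h1.trans h2) (Real.exp_nonneg _)
    _ = 1 / runScale b := by
        rw [hval, runScale, neg_div, Real.exp_neg]
        field_simp
        ring

lemma gaussianReal_real_abs_gt_le {b : ℝ} (hb : 0 < b) :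
    (gaussianReal 0 1).real {x | b < |x|} ≤ 2 / runScale b := by
  have hset : {x : ℝ | b < |x|} = Set.Ioi b ∪ (fun x => -x) ⁻¹' Set.Ioi b := by
    ext x
    simp only [Set.mem_ofPred_eq, Set.mem_union, Set.mem_Ioi, Set.mem_preimage, lt_abs]
  have hneg : (gaussianReal 0 1).real ((fun x => -x) ⁻¹' Set.Ioi b)
      = (gaussianReal 0 1).real (Set.Ioi b) := by
    have h := gaussianReal_map_neg (μ := 0) (v := 1)
    rw [neg_zero] at h
    conv_rhs => rw [← h]
    rw [map_measureReal_apply measurable_neg measurableSet_Ioi]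
  rw [hset]
  refine (measureReal_union_le _ _).trans ?_
  rw [hneg]
  have := gaussianReal_real_Ioi_le hb
  have h2 : 2 / runScale b = 1 / runScale b + 1 / runScale b := by ring
  linarith

/-! ### Normalisation and covariance of the cluster statistics -/

lemma invSqrt_isHermitian {n : Type*} [Fintype n] [DecidableEq n] (A : Matrix n n ℝ) :
    (invSqrt A).IsHermitian :=
  cfc_predicate (p := IsSelfAdjoint) (fun x : ℝ => (√x)⁻¹) A

lemma invSqrt_mul_mul_invSqrt {n : Type*} [Fintype n] [DecidableEq n] {A : Matrix n n ℝ}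
    (hA : A.PosDef) : invSqrt A * A * invSqrt A = 1 := by
  have hsa : IsSelfAdjoint A := hA.isHermitian
  have hpos : ∀ x ∈ spectrum ℝ A, 0 < x := by
    intro x hx
    rw [hA.isHermitian.spectrum_real_eq_range_eigenvalues] at hx
    obtain ⟨i, rfl⟩ := hx
    exact hA.eigenvalues_pos i
  have hc : ContinuousOn (fun x : ℝ => (√x)⁻¹) (spectrum ℝ A) :=
    Real.continuous_sqrt.continuousOn.inv₀ fun x hx => (Real.sqrt_pos.2 (hpos x hx)).ne'
  have h1 : invSqrt A * A = cfc (fun x : ℝ => (√x)⁻¹ * x) A := by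
    rw [cfc_mul _ (fun x => x) A hc continuousOn_id, cfc_id' ℝ A, invSqrt]
  rw [h1, invSqrt, ← cfc_mul (fun x : ℝ => (√x)⁻¹ * x) _ A (hc.mul continuousOn_id) hc]
  conv_rhs => rw [← cfc_one ℝ A]
  refine cfc_congr fun x hx => ?_
  have h0 := hpos x hx
  have h2 : √x * √x = x := Real.mul_self_sqrt h0.le
  have h3 : √x ≠ 0 := (Real.sqrt_pos.2 h0).ne'
  simp only [Pi.one_apply]
  field_simp
  rw [pow_two, h2]

variable {Ω : Type*} {M L : ℕ} {I : Matrix (Edge M) (Edge M) ℝ} {S : ℝ → Edge M → Ω → ℝ}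

/-- The coefficients of the window scores in the statistic of a cluster. -/
noncomputable def statCoeff (I : Matrix (Edge M) (Edge M) ℝ) (E : Finset (Edge M)) (w : ℝ) :
    E → ℝ :=
  (√(w * (E.card : ℝ)))⁻¹ • Matrix.mulVec (invSqrt (clusterInfo I E)) (fun _ => 1)

lemma clusterStat_eq_sum (E : Finset (Edge M)) (w t : ℝ) (ω : Ω) :
    clusterStat S I E w t ω = ∑ e : E, statCoeff I E w e * (S t e ω - S (t - w) e ω) := by
  have h : (invSqrt (clusterInfo I E)).transpose = invSqrt (clusterInfo I E) := by
    have := invSqrt_isHermitian (clusterInfo I E)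
    rwa [Matrix.IsHermitian, Matrix.conjTranspose_eq_transpose_of_trivial] at this
  rw [clusterStat, Matrix.dotProduct_mulVec, ← Matrix.mulVec_transpose, h]
  simp only [dotProduct, statCoeff, windowScore, Finset.mul_sum, Pi.smul_apply, smul_eq_mul,
    mul_assoc]

/-- This is the unit variance of a cluster statistic: with `A = I_E^{-1/2}`, the identity `A I_E A =
1` leaves `1ᵀ 1 = R`, which cancels against the prefactor. -/
lemma statCoeff_quadratic_form {E : Finset (Edge M)} (hE : E.Nonempty)
    (hI : (clusterInfo I E).PosDef) {w : ℝ} (hw : 0 < w) :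
    ∑ e : E, ∑ e' : E, statCoeff I E w e * (statCoeff I E w e' * (w * I e e')) = 1 := by
  have hT : (invSqrt (clusterInfo I E)).transpose = invSqrt (clusterInfo I E) := by
    have := invSqrt_isHermitian (clusterInfo I E)
    rwa [Matrix.IsHermitian, Matrix.conjTranspose_eq_transpose_of_trivial] at this
  set A := invSqrt (clusterInfo I E) with hA
  set u : E → ℝ := fun _ => 1 with hu
  have hcard : (0 : ℝ) < E.card := by exact_mod_cast hE.card_pos
  have h1 : ∑ e : E, ∑ e' : E, statCoeff I E w e * (statCoeff I E w e' * (w * I e e'))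
      = w * (statCoeff I E w ⬝ᵥ Matrix.mulVec (clusterInfo I E) (statCoeff I E w)) := by
    simp only [dotProduct, Matrix.mulVec, Finset.mul_sum, clusterInfo, Matrix.submatrix_apply]
    exact Finset.sum_congr rfl fun e _ => Finset.sum_congr rfl fun e' _ => by ring
  have h2 : Matrix.mulVec A u ⬝ᵥ Matrix.mulVec (clusterInfo I E) (Matrix.mulVec A u)
      = E.card := by
    have : Matrix.mulVec A u = Matrix.vecMul u A := by
      rw [← Matrix.mulVec_transpose, hT]
    rw [Matrix.mulVec_mulVec, this, ← Matrix.dotProduct_mulVec, Matrix.mulVec_mulVec, ← Matrix.mul_assoc,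
      invSqrt_mul_mul_invSqrt hI, Matrix.one_mulVec]
    simp [hu, dotProduct]
  rw [h1, statCoeff, ← hA, ← hu, Matrix.mulVec_smul, smul_dotProduct, dotProduct_smul, h2]
  have h3 : √(w * (E.card : ℝ)) * √(w * (E.card : ℝ)) = w * E.card :=
    Real.mul_self_sqrt (by positivity)
  have h4 : √(w * (E.card : ℝ)) ≠ 0 := (Real.sqrt_pos.2 (by positivity)).ne'
  simp only [smul_eq_mul]
  field_simp
  rw [pow_two, h3]

lemma lt_scanStat_iff (E : Fin L → Finset (Edge M)) (w t : ℝ) (ω : Ω) {b : ℝ} (hb : 0 < b) :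
    b < scanStat S I E w t ω ↔ ∃ i, b < |clusterStat S I (E i) w t ω| := by
  refine ⟨fun h => ?_, fun ⟨i, hi⟩ => hi.trans_le <|
    le_ciSup (f := fun i => |clusterStat S I (E i) w t ω|) (Set.finite_range _).bddAbove i⟩
  -- For `L = 0` the real supremum is `0` by convention, which `b > 0` excludes.
  rcases isEmpty_or_nonempty (Fin L) with hL | hL
  · rw [scanStat, Real.iSup_of_isEmpty] at h
    exact absurd h hb.le.not_gt
  · exact exists_lt_of_lt_ciSup h

variable [MeasurableSpace Ω] {P : Measure Ω}

lemma IsNullScore.memLp_two (hS : IsNullScore S I P) (t : ℝ) (e : Edge M) : MemLp (S t e) 2 P :=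
  (hS.gaussian.hasGaussianLaw_eval (t, e)).memLp_two

/-- For `w ≥ 0` the factor equals `max (w - |s - t|) 0`, the length of the overlap of the two
windows. -/
lemma IsNullScore.covariance_increment [IsProbabilityMeasure P] (hS : IsNullScore S I P)
    (w s t : ℝ) (e e' : Edge M) :
    cov[fun ω => S s e ω - S (s - w) e ω, fun ω => S t e' ω - S (t - w) e' ω; P]
      = (|s - t + w| + |s - t - w| - 2 * |s - t|) / 2 * I e e' := by
  have h := covariance_sub_left (hS.memLp_two s e) (hS.memLp_two (s - w) e)
    ((hS.memLp_two t e').sub (hS.memLp_two (t - w) e'))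
  rw [covariance_sub_right (hS.memLp_two _ _) (hS.memLp_two _ _) (hS.memLp_two _ _),
    covariance_sub_right (hS.memLp_two _ _) (hS.memLp_two _ _) (hS.memLp_two _ _)] at h
  simp only [hS.covariance] at h
  refine Eq.trans h ?_
  rw [show s - (t - w) = s - t + w by ring, show s - w - t = s - t - w by ring,
    show s - w - (t - w) = s - t by ring]
  ring

lemma IsNullScore.covariance_clusterStat [IsProbabilityMeasure P] (hS : IsNullScore S I P)
    (E E' : Finset (Edge M)) (w s t : ℝ) :
    cov[clusterStat S I E w s, clusterStat S I E' w t; P]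
      = ∑ e : E, ∑ e' : E', statCoeff I E w e * (statCoeff I E' w e' *
          ((|s - t + w| + |s - t - w| - 2 * |s - t|) / 2 * I e e')) := by
  have h (E : Finset (Edge M)) (s : ℝ) : clusterStat S I E w s
      = fun ω => ∑ e : E, statCoeff I E w e * (S s e ω - S (s - w) e ω) :=
    funext fun ω => clusterStat_eq_sum E w s ω
  rw [h E, h E', covariance_fun_sum_fun_sum]
  · simp only [covariance_const_mul_left, covariance_const_mul_right, hS.covariance_increment]
    exact Finset.sum_congr rfl fun e _ => Finset.sum_congr rfl fun e' _ => by ring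
  · exact fun e => ((hS.memLp_two _ _).sub (hS.memLp_two _ _)).const_mul _
  · exact fun e => ((hS.memLp_two _ _).sub (hS.memLp_two _ _)).const_mul _

/-- Each statistic is a finite linear combination of scores at `t` and `t - w`. Joint Gaussianity
over clusters and times is what later turns zero covariance into independence. -/
lemma IsNullScore.isGaussianProcess_clusterStat (hS : IsNullScore S I P)
    (E : Fin L → Finset (Edge M)) (w : ℝ) :
    IsGaussianProcess (fun (a : Fin L × ℝ) ω => clusterStat S I (E a.1) w a.2 ω) P := by
  classical
  refine hS.gaussian.of_isGaussianProcess fun a => ?_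
  let J : Finset (ℝ × Edge M) := ({a.2, a.2 - w} : Finset ℝ) ×ˢ Finset.univ
  refine ⟨J, ∑ e : E a.1, statCoeff I (E a.1) w e •
    (ContinuousLinearMap.proj (R := ℝ) (φ := fun _ : J => ℝ) ⟨(a.2, e.1), by simp [J]⟩ -
      ContinuousLinearMap.proj (R := ℝ) (φ := fun _ : J => ℝ) ⟨(a.2 - w, e.1), by simp [J]⟩), ?_⟩
  intro ω
  rw [clusterStat_eq_sum]
  simp

lemma IsNullScore.aemeasurable_clusterStat (hS : IsNullScore S I P)
    (E : Finset (Edge M)) (w t : ℝ) : AEMeasurable (clusterStat S I E w t) P :=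
  (hS.isGaussianProcess_clusterStat (fun _ : Fin 1 => E) w).aemeasurable (0, t)

lemma IsNullScore.map_clusterStat [IsProbabilityMeasure P] (hS : IsNullScore S I P)
    {E : Finset (Edge M)} (hE : E.Nonempty) (hI : (clusterInfo I E).PosDef) {w : ℝ} (hw : 0 < w)
    (t : ℝ) : P.map (clusterStat S I E w t) = gaussianReal 0 1 := by
  have hG : HasGaussianLaw (clusterStat S I E w t) P :=
    (hS.isGaussianProcess_clusterStat (fun _ : Fin 1 => E) w).hasGaussianLaw_eval (0, t)
  have hmean : ∫ ω, clusterStat S I E w t ω ∂P = 0 := by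
    have hint (t : ℝ) (e : Edge M) : Integrable (S t e) P :=
      (hS.memLp_two t e).integrable one_le_two
    simp only [clusterStat_eq_sum]
    have hd (e : E) :
        Integrable (fun ω => statCoeff I E w e * (S t e ω - S (t - w) e ω)) P :=
      ((hint t e).sub (hint (t - w) e)).const_mul _
    rw [integral_finsetSum _ fun e _ => hd e]
    refine Finset.sum_eq_zero fun e _ => ?_
    rw [integral_const_mul, integral_sub (hint _ _) (hint _ _), hS.mean_zero, hS.mean_zero]
    simp
  have hvar : Var[clusterStat S I E w t; P] = 1 := by
    rw [← covariance_self (hS.aemeasurable_clusterStat E w t), hS.covariance_clusterStat,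
      ← statCoeff_quadratic_form hE hI hw]
    simp only [sub_self, zero_add, zero_sub, abs_neg, abs_zero, abs_of_pos hw]
    refine Finset.sum_congr rfl fun e _ => Finset.sum_congr rfl fun e' _ => by ring
  rw [hG.map_eq_gaussianReal, hmean, hvar]
  simp

lemma IsNullScore.measureReal_clusterStat_gt_le [IsProbabilityMeasure P] (hS : IsNullScore S I P)
    {E : Finset (Edge M)} (hE : E.Nonempty) (hI : (clusterInfo I E).PosDef) {w : ℝ} (hw : 0 < w)
    (t : ℝ) {b : ℝ} (hb : 0 < b) :
    P.real {ω | b < |clusterStat S I E w t ω|} ≤ 2 / runScale b := by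
  refine le_trans (le_of_eq ?_) (gaussianReal_real_abs_gt_le hb)
  rw [← hS.map_clusterStat hE hI hw t,
    map_measureReal_apply_of_aemeasurable (hS.aemeasurable_clusterStat E w t)
      (measurableSet_lt measurable_const continuous_abs.measurable)]
  rfl

lemma IsNullScore.aemeasurable_scanStat (hS : IsNullScore S I P)
    (E : Fin L → Finset (Edge M)) (w t : ℝ) : AEMeasurable (scanStat S I E w t) P :=
  AEMeasurable.iSup fun i => continuous_abs.measurable.comp_aemeasurable
    (hS.aemeasurable_clusterStat (E i) w t)

lemma IsNullScore.measureReal_scanStat_gt_le [IsProbabilityMeasure P] (hS : IsNullScore S I P)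
    {E : Fin L → Finset (Edge M)} (hE : ∀ i, (E i).Nonempty)
    (hI : ∀ i, (clusterInfo I (E i)).PosDef) {w : ℝ} (hw : 0 < w)
    (t : ℝ) {b : ℝ} (hb : 0 < b) :
    P.real {ω | b < scanStat S I E w t ω} ≤ 2 * L / runScale b := by
  have hset : {ω | b < scanStat S I E w t ω}
      = ⋃ i, {ω | b < |clusterStat S I (E i) w t ω|} := by
    ext ω
    simp [lt_scanStat_iff E w t ω hb]
  rw [hset]
  refine (measureReal_iUnion_fintype_le _).trans ?_
  refine (Finset.sum_le_sum fun i _ =>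
    hS.measureReal_clusterStat_gt_le (hE i) (hI i) hw t hb).trans (le_of_eq ?_)
  simp
  ring

/-! ### Independence of separated blocks -/

/-- Statistics whose windows do not overlap are independent; this is applied to the blocks of
indices `((j - 1) m + q, j m]`, which are separated by at least `q` indices. -/
lemma IsNullScore.measureReal_iInter_block_compl [IsProbabilityMeasure P] (hS : IsNullScore S I P)
    (E : Fin L → Finset (Edge M)) {w δ : ℝ} (hw : 0 < w) (hδ : 0 < δ) (b : ℝ) (m k q : ℕ)
    (hq : w ≤ q * δ) :
    P.real (⋂ j ∈ Finset.Icc 1 k, (⋃ n ∈ Finset.Ioc ((j - 1) * m + q) (j * m),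
        {ω | b < scanStat S I E w (n * δ) ω})ᶜ)
      = ∏ j ∈ Finset.Icc 1 k, P.real (⋃ n ∈ Finset.Ioc ((j - 1) * m + q) (j * m),
        {ω | b < scanStat S I E w (n * δ) ω})ᶜ := by
  let ι : ℕ → Type := fun j => Fin L × Finset.Ioc ((j - 1) * m + q) (j * m)
  let X : (j : ℕ) → ι j → Ω → ℝ := fun j a => clusterStat S I (E a.1) w ((a.2 : ℕ) * δ)
  have hX : IsGaussianProcess (fun (p : (j : ℕ) × ι j) ω => X p.1 p.2 ω) P :=
    (hS.isGaussianProcess_clusterStat E w).comp_right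
      (fun p : (j : ℕ) × ι j => (p.2.1, ((p.2.2 : ℕ) : ℝ) * δ))
  have hsep : ∀ i j, i < j → ∀ (a : ι i) (c : ι j), w ≤ ((c.2 : ℕ) : ℝ) * δ - (a.2 : ℕ) * δ := by
    intro i j hij a c
    have h1 := (Finset.mem_Ioc.1 a.2.2).2
    have h2 := (Finset.mem_Ioc.1 c.2.2).1
    have h3 : i * m ≤ (j - 1) * m := Nat.mul_le_mul_right m (by omega)
    have h4 : ((a.2 : ℕ) : ℝ) + q ≤ (c.2 : ℕ) := by
      exact_mod_cast (by omega : (a.2 : ℕ) + q ≤ (c.2 : ℕ))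
    nlinarith
  have hind : iIndepFun (fun j ω a => X j a ω) P := by
    refine hX.iIndepFun_of_covariance_eq_zero (fun j a => hS.aemeasurable_clusterStat _ _ _) ?_
    intro i j hij a c
    have hzero : |((a.2 : ℕ) : ℝ) * δ - (c.2 : ℕ) * δ + w| + |((a.2 : ℕ) : ℝ) * δ - (c.2 : ℕ) * δ - w|
        - 2 * |((a.2 : ℕ) : ℝ) * δ - (c.2 : ℕ) * δ| = 0 := by
      rcases lt_or_gt_of_ne hij with h | h
      · have := hsep i j h a c
        rw [abs_of_nonpos (by linarith), abs_of_nonpos (by linarith), abs_of_nonpos (by linarith)]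
        ring
      · have := hsep j i h c a
        rw [abs_of_nonneg (by linarith), abs_of_nonneg (by linarith), abs_of_nonneg (by linarith)]
        ring
    simp only [X]
    rw [hS.covariance_clusterStat, hzero]
    simp
  let B : (j : ℕ) → Set (ι j → ℝ) := fun j =>
    (⋃ n : Finset.Ioc ((j - 1) * m + q) (j * m), {y | b < ⨆ i : Fin L, |y (i, n)|})ᶜ
  have hB : ∀ j, MeasurableSet (B j) := fun j => by
    refine (MeasurableSet.iUnion fun n => measurableSet_lt measurable_const ?_).compl
    exact Measurable.iSup fun i => continuous_abs.measurable.comp (measurable_pi_apply _)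
  have hpre : ∀ j, (⋃ n ∈ Finset.Ioc ((j - 1) * m + q) (j * m),
      {ω | b < scanStat S I E w (n * δ) ω})ᶜ = (fun ω a => X j a ω) ⁻¹' (B j) := by
    intro j
    ext ω
    simp only [B, X, ι, scanStat, Set.mem_compl_iff, Set.mem_iUnion, Set.mem_ofPred_eq,
      Set.mem_preimage, Subtype.exists, exists_prop]
  simp only [hpre]
  have := hind.measure_inter_preimage_eq_mul (Finset.Icc 1 k) (sets := B) fun j _ => hB j
  rw [Measure.real, this, ENNReal.toReal_prod]
  rfl

end HawkesScan

namespace HawkesScan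

/-! ### Poisson approximation for blocks -/

/-- Replace one factor at a time; the remaining factors are at most `1`. -/
lemma abs_prod_sub_prod_le {ι : Type*} (s : Finset ι) {u v : ι → ℝ}
    (hu : ∀ i ∈ s, u i ∈ Set.Icc (0 : ℝ) 1) (hv : ∀ i ∈ s, v i ∈ Set.Icc (0 : ℝ) 1) :
    |∏ i ∈ s, u i - ∏ i ∈ s, v i| ≤ ∑ i ∈ s, |u i - v i| := by
  classical
  induction s using Finset.induction_on with
  | empty => simp
  | insert a s ha ih =>
    rw [Finset.prod_insert ha, Finset.prod_insert ha, Finset.sum_insert ha]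
    have hu' := fun i hi => hu i (Finset.mem_insert_of_mem hi)
    have hv' := fun i hi => hv i (Finset.mem_insert_of_mem hi)
    have ha1 := hu a (Finset.mem_insert_self a s)
    have hp0 : 0 ≤ ∏ i ∈ s, v i := Finset.prod_nonneg fun i hi => (hv' i hi).1
    have hp1 : ∏ i ∈ s, v i ≤ 1 := Finset.prod_le_one (fun i hi => (hv' i hi).1)
      fun i hi => (hv' i hi).2
    calc |u a * ∏ i ∈ s, u i - v a * ∏ i ∈ s, v i|
        = |(u a - v a) * ∏ i ∈ s, v i + u a * (∏ i ∈ s, u i - ∏ i ∈ s, v i)| := by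
          congr 1; ring
      _ ≤ |u a - v a| * 1 + 1 * |∏ i ∈ s, u i - ∏ i ∈ s, v i| := by
          refine (abs_add_le _ _).trans ?_
          rw [abs_mul, abs_mul, abs_of_nonneg hp0, abs_of_nonneg ha1.1]
          gcongr
          exact ha1.2
      _ ≤ _ := by
          rw [mul_one, one_mul]
          gcongr
          exact ih hu' hv'

lemma abs_one_sub_sub_exp_neg_le {a : ℝ} (h0 : 0 ≤ a) (h1 : a ≤ 1) :
    |(1 - a) - Real.exp (-a)| ≤ a ^ 2 := by
  have h := Real.abs_exp_sub_one_sub_id_le (x := -a) (by rwa [abs_neg, abs_of_nonneg h0])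
  rw [abs_sub_comm, neg_sq] at h
  convert! h using 2
  ring

lemma abs_exp_neg_sub_exp_neg_le {a c : ℝ} (ha : 0 ≤ a) (hac : a ≤ c) :
    |Real.exp (-a) - Real.exp (-c)| ≤ c - a := by
  have h1 : Real.exp (-c) ≤ Real.exp (-a) := Real.exp_le_exp.2 (by linarith)
  rw [abs_of_nonneg (by linarith)]
  have h2 : Real.exp (-c) = Real.exp (-a) * Real.exp (-(c - a)) := by
    rw [← Real.exp_add]; ring_nf
  have h3 := Real.add_one_le_exp (-(c - a))
  have h4 : Real.exp (-a) ≤ 1 := Real.exp_le_one_iff.2 (by linarith)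
  have h5 := Real.exp_pos (-a)
  rw [h2]
  nlinarith

variable {Ω : Type*} [MeasurableSpace Ω] {P : Measure Ω}

lemma measureReal_biUnion_le_card_mul {ι : Type*} {A : ι → Set Ω} {p : ℝ}
    (hA : ∀ n, P.real (A n) ≤ p) (s : Finset ι) : P.real (⋃ n ∈ s, A n) ≤ s.card * p :=
  (measureReal_biUnion_finset_le s A).trans <|
    (Finset.sum_le_sum fun n _ => hA n).trans (le_of_eq (by simp))

/-- Poisson approximation for the number of blocks that contain an exceedance, provided that the
blocks become independent when their first `q` indices are removed. -/
lemma abs_measureReal_compl_sub_exp_le [IsProbabilityMeasure P] {A : ℕ → Set Ω} (hAm : ∀ n, NullMeasurableSet (A n) P)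
    {p : ℝ} (hA : ∀ n, P.real (A n) ≤ p) {m k q N : ℕ} (hN : k * m ≤ N) (hN' : N ≤ k * m + m)
    (hind : P.real (⋂ j ∈ Finset.Icc 1 k, (⋃ n ∈ Finset.Ioc ((j - 1) * m + q) (j * m), A n)ᶜ)
      = ∏ j ∈ Finset.Icc 1 k, P.real (⋃ n ∈ Finset.Ioc ((j - 1) * m + q) (j * m), A n)ᶜ) :
    |P.real (⋃ n ∈ Finset.Ioc 0 N, A n)ᶜ
        - Real.exp (-∑ j ∈ Finset.Icc 1 k, P.real (⋃ n ∈ Finset.Ioc ((j - 1) * m) (j * m), A n))|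
      ≤ m * p + 2 * (k * (q * p)) + k * (m * p) ^ 2 := by
  set U := ⋃ n ∈ Finset.Ioc 0 N, A n with hU
  set B : ℕ → Set Ω := fun j => ⋃ n ∈ Finset.Ioc ((j - 1) * m) (j * m), A n with hB
  set B' : ℕ → Set Ω := fun j => ⋃ n ∈ Finset.Ioc ((j - 1) * m + q) (j * m), A n with hB'
  -- `G j` covers the removed indices. If `q > m` it overruns the block, which is harmless since it
  -- only enters upper bounds.
  set G : ℕ → Set Ω := fun j => ⋃ n ∈ Finset.Ioc ((j - 1) * m) ((j - 1) * m + q), A n with hG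
  set V := ⋃ j ∈ Finset.Icc 1 k, B' j with hV
  have hp : 0 ≤ p := measureReal_nonneg.trans (hA 0)
  have hnull (s : Finset ℕ) : NullMeasurableSet (⋃ n ∈ s, A n) P :=
    s.nullMeasurableSet_biUnion fun n _ => hAm n
  have hVm : NullMeasurableSet V P := Finset.nullMeasurableSet_biUnion _ fun j _ => hnull _
  have hGp (j : ℕ) : P.real (G j) ≤ q * p :=
    (measureReal_biUnion_le_card_mul hA _).trans (le_of_eq (by simp))
  have hsum : ∑ j ∈ Finset.Icc 1 k, P.real (G j) ≤ k * (q * p) :=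
    (Finset.sum_le_sum fun j _ => hGp j).trans (le_of_eq (by simp))
  have hB'B (j : ℕ) : B' j ⊆ B j :=
    Set.biUnion_subset_biUnion_left fun n hn => by
      have := Finset.mem_Ioc.1 hn
      exact Finset.mem_Ioc.2 ⟨by omega, this.2⟩
  have hBG (j : ℕ) : B j ⊆ B' j ∪ G j := by
    intro ω hω
    simp only [hB, hB', hG, Set.mem_union, Set.mem_iUnion, Finset.mem_Ioc, exists_prop] at hω ⊢
    obtain ⟨n, hn, hω⟩ := hω
    rcases le_or_gt n ((j - 1) * m + q) with h | h
    · exact Or.inr ⟨n, ⟨hn.1, h⟩, hω⟩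
    · exact Or.inl ⟨n, ⟨h, hn.2⟩, hω⟩
  have hVU : V ⊆ U := by
    intro ω hω
    simp only [hV, hB', hU, Set.mem_iUnion, Finset.mem_Ioc, Finset.mem_Icc, exists_prop] at hω ⊢
    obtain ⟨j, hj, n, hn, hω⟩ := hω
    have := Nat.mul_le_mul_right m hj.2
    exact ⟨n, ⟨by omega, by omega⟩, hω⟩
  have hUV : U ⊆ V ∪ ((⋃ n ∈ Finset.Ioc (k * m) N, A n) ∪ ⋃ j ∈ Finset.Icc 1 k, G j) := by
    intro ω hω
    simp only [hU, Set.mem_iUnion, Finset.mem_Ioc, exists_prop] at hω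
    obtain ⟨n, hn, hω⟩ := hω
    rcases le_or_gt n (k * m) with h | h
    · have hm : 0 < m := Nat.pos_of_ne_zero fun h0 => by simp [h0] at h; omega
      -- Blocks are open on the left, so index `n` belongs to block `⌊(n - 1) / m⌋ + 1`.
      have hj : ω ∈ B ((n - 1) / m + 1) := by
        simp only [hB, Set.mem_iUnion, Finset.mem_Ioc, exists_prop, Nat.add_sub_cancel]
        have h1 := Nat.div_mul_le_self (n - 1) m
        have h2 := Nat.lt_div_mul_add (a := n - 1) hm
        refine ⟨n, ⟨by omega, ?_⟩, hω⟩
        rw [add_mul, one_mul]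
        omega
      have hjk : (n - 1) / m + 1 ∈ Finset.Icc 1 k := by
        have : (n - 1) / m < k := by
          rw [Nat.div_lt_iff_lt_mul hm]
          omega
        exact Finset.mem_Icc.2 ⟨Nat.le_add_left _ _, this⟩
      rcases hBG _ hj with h' | h'
      · exact Or.inl (Set.mem_biUnion hjk h')
      · exact Or.inr (Or.inr (Set.mem_biUnion hjk h'))
    · exact Or.inr (Or.inl (Set.mem_biUnion (Finset.mem_Ioc.2 ⟨h, hn.2⟩) hω))
  have hUVp : P.real U ≤ P.real V + (m * p + k * (q * p)) := by
    refine (measureReal_mono hUV).trans ((measureReal_union_le _ _).trans ?_)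
    gcongr
    refine (measureReal_union_le _ _).trans (add_le_add ?_ ?_)
    · refine (measureReal_biUnion_le_card_mul hA _).trans ?_
      gcongr
      simp only [Nat.card_Ioc]
      omega
    · exact (measureReal_biUnion_finset_le _ _).trans hsum
  have hUc : P.real Uᶜ = 1 - P.real U := probReal_compl_eq_one_sub₀ (hnull _)
  have hVc : P.real Vᶜ = ∏ j ∈ Finset.Icc 1 k, (1 - P.real (B' j)) := by
    rw [hV, Set.compl_iUnion₂, hind]
    exact Finset.prod_congr rfl fun j _ => probReal_compl_eq_one_sub₀ (hnull _)
  have hVc' : P.real Vᶜ = 1 - P.real V := probReal_compl_eq_one_sub₀ hVm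
  have h1 : |P.real Uᶜ - P.real Vᶜ| ≤ m * p + k * (q * p) := by
    have := measureReal_mono hVU (measure_ne_top P U)
    rw [hUc, hVc', abs_le]
    constructor <;> linarith
  have hB'p (j : ℕ) : P.real (B' j) ≤ m * p := by
    refine (measureReal_mono (hB'B j) (measure_ne_top P (B j))).trans ((measureReal_biUnion_le_card_mul hA _).trans ?_)
    gcongr
    simp only [Nat.card_Ioc, Nat.sub_mul, one_mul]
    omega
  have h2 : |P.real Vᶜ - Real.exp (-∑ j ∈ Finset.Icc 1 k, P.real (B' j))| ≤ k * (m * p) ^ 2 := by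
    rw [hVc, ← Finset.sum_neg_distrib, Real.exp_sum]
    refine (abs_prod_sub_prod_le _ (fun j _ => ⟨?_, ?_⟩) fun j _ => ⟨(Real.exp_pos _).le, ?_⟩).trans ?_
    · linarith [measureReal_le_one (μ := P) (s := B' j)]
    · linarith [measureReal_nonneg (μ := P) (s := B' j)]
    · exact Real.exp_le_one_iff.2 (by linarith [measureReal_nonneg (μ := P) (s := B' j)])
    · refine (Finset.sum_le_sum fun j _ => (abs_one_sub_sub_exp_neg_le measureReal_nonneg
        measureReal_le_one).trans (pow_le_pow_left₀ measureReal_nonneg (hB'p j) 2)).trans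
        (le_of_eq (by simp))
  -- Restoring the removed indices in the exponent costs `k q p` a second time.
  have h3 : |Real.exp (-∑ j ∈ Finset.Icc 1 k, P.real (B' j))
      - Real.exp (-∑ j ∈ Finset.Icc 1 k, P.real (B j))| ≤ k * (q * p) := by
    refine (abs_exp_neg_sub_exp_neg_le (Finset.sum_nonneg fun j _ => measureReal_nonneg)
      (Finset.sum_le_sum fun j _ => measureReal_mono (hB'B j) (measure_ne_top P (B j)))).trans ?_
    rw [← Finset.sum_sub_distrib]
    refine (Finset.sum_le_sum fun j _ => ?_).trans hsum
    linarith [(measureReal_mono (hBG j) (measure_ne_top P (B' j ∪ G j))).trans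
      (measureReal_union_le _ _)]
  have h4 := abs_sub_le (P.real Uᶜ) (P.real Vᶜ)
    (Real.exp (-∑ j ∈ Finset.Icc 1 k, P.real (B j)))
  have h5 := abs_sub_le (P.real Vᶜ) (Real.exp (-∑ j ∈ Finset.Icc 1 k, P.real (B' j)))
    (Real.exp (-∑ j ∈ Finset.Icc 1 k, P.real (B j)))
  linarith

end HawkesScan

namespace HawkesScan

/-! ### The stopping time and the limit -/

variable {Ω : Type*} {M L : ℕ} {I : Matrix (Edge M) (Edge M) ℝ} {S : ℝ → Edge M → Ω → ℝ}

lemma setOf_lt_stopTime_eq (E : Fin L → Finset (Edge M)) (w b : ℝ) {δ : ℝ} (hδ : 0 < δ)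
    {y : ℝ} (hy : 0 ≤ y) :
    {ω | ((y * δ : ℝ) : EReal) < stopTime S I E w δ b ω}
      = (⋃ n ∈ Finset.Ioc 0 ⌊y⌋₊, {ω | b < scanStat S I E w (n * δ) ω})ᶜ := by
  ext ω
  simp only [Set.mem_ofPred_eq, Set.mem_compl_iff, Set.mem_iUnion, Finset.mem_Ioc, exists_prop,
    not_exists, not_and, stopTime]
  constructor
  · intro h n hn hb
    have h1 : sInf {T : EReal | ∃ n : ℕ, 1 ≤ n ∧ b < scanStat S I E w (n * δ) ω ∧
        T = ((n * δ : ℝ) : EReal)} ≤ ((n * δ : ℝ) : EReal) := sInf_le ⟨n, hn.1, hb, rfl⟩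
    have h2 : y * δ < n * δ := EReal.coe_lt_coe_iff.1 (h.trans_le h1)
    have h3 : (n : ℝ) ≤ y := (Nat.le_floor_iff hy).1 hn.2
    nlinarith
  · intro h
    -- Every alarm comes at or after the next update time `(⌊y⌋ + 1) δ`, so the strict inequality
    -- survives the infimum.
    have h1 : y * δ < ((⌊y⌋₊ + 1 : ℕ) : ℝ) * δ := by
      have := Nat.lt_floor_add_one y
      push_cast
      gcongr
    refine (EReal.coe_lt_coe_iff.2 h1).trans_le (le_sInf ?_)
    rintro T ⟨n, hn, hb, rfl⟩
    have h2 : ⌊y⌋₊ + 1 ≤ n := by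
      by_contra hlt
      exact h n ⟨hn, by omega⟩ hb
    have h3 : ((⌊y⌋₊ + 1 : ℕ) : ℝ) ≤ n := by exact_mod_cast h2
    exact EReal.coe_le_coe_iff.2 (by gcongr)

lemma blockEvent_eq (E : Fin L → Finset (Edge M)) (w δ b : ℝ) (m j : ℕ) :
    blockEvent S I E w δ b m j
      = ⋃ n ∈ Finset.Ioc ((j - 1) * m) (j * m), {ω | b < scanStat S I E w (n * δ) ω} := by
  ext ω
  simp [blockEvent]

variable [MeasurableSpace Ω] {P : Measure Ω}

lemma IsNullScore.nullMeasurableSet_scanStat_gt (hS : IsNullScore S I P)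
    (E : Fin L → Finset (Edge M)) (w t b : ℝ) :
    NullMeasurableSet {ω | b < scanStat S I E w t ω} P :=
  nullMeasurableSet_lt aemeasurable_const (hS.aemeasurable_scanStat E w t)

lemma IsNullScore.integral_blockCount [IsProbabilityMeasure P] (hS : IsNullScore S I P)
    (E : Fin L → Finset (Edge M)) (w δ b : ℝ) (m k : ℕ) :
    ∫ ω, blockCount S I E w δ b m k ω ∂P
      = ∑ j ∈ Finset.Icc 1 k, P.real (blockEvent S I E w δ b m j) := by
  have hm (j : ℕ) : NullMeasurableSet (blockEvent S I E w δ b m j) P := by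
    rw [blockEvent_eq]
    exact Finset.nullMeasurableSet_biUnion _ fun n _ => hS.nullMeasurableSet_scanStat_gt E w _ b
  simp only [blockCount]
  rw [integral_finsetSum _ fun j _ => (integrable_const (1 : ℝ)).indicator₀ (hm j)]
  refine Finset.sum_congr rfl fun j _ => ?_
  rw [integral_indicator₀ (hm j)]
  simp

/-- The non-asymptotic form of the approximation. -/
lemma IsNullScore.abs_measureReal_stopTime_sub_exp_le [IsProbabilityMeasure P]
    (hS : IsNullScore S I P)
    {E : Fin L → Finset (Edge M)} (hE : ∀ i, (E i).Nonempty)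
    (hI : ∀ i, (clusterInfo I (E i)).PosDef) {w δ b : ℝ} (hδ : 0 < δ) (hδw : δ ≤ w) (hb : 0 < b)
    {m : ℕ} (hm : 0 < m) {x : ℝ} (hx : 0 ≤ x) :
    |P.real {ω | ((x * runScale b * δ : ℝ) : EReal) < stopTime S I E w δ b ω}
        - Real.exp (-∫ ω, blockCount S I E w δ b m ⌊x * runScale b / (m : ℝ)⌋₊ ω ∂P)|
      ≤ (2 * L + x * (2 * L) ^ 2) * (m / runScale b) + 8 * L * x * (w / δ / m) := by
  have hf : 0 < runScale b := mul_pos hb (Real.exp_pos _)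
  have hw : 0 < w := hδ.trans_le hδw
  have hy : 0 ≤ x * runScale b := mul_nonneg hx hf.le
  have hm' : (0 : ℝ) < m := by exact_mod_cast hm
  set k := ⌊x * runScale b / (m : ℝ)⌋₊ with hk
  set q := ⌈w / δ⌉₊ with hq
  have hkle : (k : ℝ) ≤ x * runScale b / m := Nat.floor_le (by positivity)
  have hklt : x * runScale b / m < k + 1 := Nat.lt_floor_add_one _
  have hwδ : 1 ≤ w / δ := (one_le_div hδ).2 hδw
  -- Rounding up costs at most a factor `2` because `w / δ ≥ 1`.
  have hqle : (q : ℝ) ≤ 2 * (w / δ) := by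
    linarith [Nat.ceil_lt_add_one (zero_le_one.trans hwδ)]
  have hqw : w ≤ q * δ := (div_le_iff₀ hδ).1 (Nat.le_ceil _)
  have hN : k * m ≤ ⌊x * runScale b⌋₊ := by
    apply Nat.le_floor
    push_cast
    exact (le_div_iff₀ hm').1 hkle
  have hN' : ⌊x * runScale b⌋₊ ≤ k * m + m := by
    apply Nat.floor_le_of_le
    push_cast
    rw [div_lt_iff₀ hm'] at hklt
    linarith
  have key := abs_measureReal_compl_sub_exp_le (P := P)
    (A := fun n : ℕ => {ω | b < scanStat S I E w (n * δ) ω})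
    (fun n => hS.nullMeasurableSet_scanStat_gt E w _ b)
    (fun n => hS.measureReal_scanStat_gt_le hE hI hw _ hb) hN hN'
    (hS.measureReal_iInter_block_compl E hw hδ b m k q hqw)
  rw [setOf_lt_stopTime_eq E w b hδ hy, hS.integral_blockCount]
  simp only [blockEvent_eq]
  refine key.trans ?_
  have h1 : (k : ℝ) * (q * (2 * L / runScale b))
      ≤ x * runScale b / m * (2 * (w / δ) * (2 * L / runScale b)) := by gcongr
  have h2 : (k : ℝ) * (m * (2 * L / runScale b)) ^ 2
      ≤ x * runScale b / m * (m * (2 * L / runScale b)) ^ 2 := by gcongr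
  have h3 : x * runScale b / m * (2 * (w / δ) * (2 * L / runScale b))
      = 4 * L * x * (w / δ / m) := by field_simp; ring
  have h4 : x * runScale b / m * (m * (2 * L / runScale b)) ^ 2
      = x * (2 * L) ^ 2 * (m / runScale b) := by field_simp
  have h5 : (m : ℝ) * (2 * L / runScale b) = 2 * L * (m / runScale b) := by ring
  rw [h3] at h1
  rw [h4] at h2
  rw [h5] at h2 ⊢
  linarith

end HawkesScan

open HawkesScan in
theorem theorem4 {Ω : Type*} [MeasurableSpace Ω] (P : Measure Ω) [IsProbabilityMeasure P]
    {M L : ℕ}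
    -- Fisher information, clusters, and the score process under the null hypothesis
    (I : Matrix (Edge M) (Edge M) ℝ) (E : Fin L → Finset (Edge M))
    (hE : ∀ i, (E i).Nonempty) (hI : ∀ i, (clusterInfo I (E i)).PosDef)
    (S : ℝ → Edge M → Ω → ℝ) (hS : IsNullScore S I P)
    -- window length, update interval and block length, which may vary with the threshold `b`
    (w δ : ℝ → ℝ) (m : ℝ → ℕ)
    (hδ : ∀ b, 0 < δ b) (hδw : ∀ b, δ b ≤ w b)
    (hwm : Tendsto (fun b => (w b / δ b) / (m b : ℝ)) atTop (𝓝 0))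
    (hmpos : ∀ b, 0 < m b)
    (hmf : Tendsto (fun b => (m b : ℝ) / runScale b) atTop (𝓝 0))
    (x : ℝ) (hx : 0 ≤ x) :
    Tendsto
      (fun b : ℝ =>
        |P.real {ω | ((x * runScale b * δ b : ℝ) : EReal) < stopTime S I E (w b) (δ b) b ω}
          - Real.exp (-∫ ω, blockCount S I E (w b) (δ b) b (m b)
              ⌊x * runScale b / (m b : ℝ)⌋₊ ω ∂P)|)
      atTop (𝓝 0) := by
  have hlim : Tendsto (fun b => (2 * L + x * (2 * L) ^ 2) * ((m b : ℝ) / runScale b)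
      + 8 * L * x * (w b / δ b / (m b : ℝ))) atTop (𝓝 0) := by
    simpa using (hmf.const_mul (2 * L + x * (2 * L) ^ 2 : ℝ)).add (hwm.const_mul (8 * L * x : ℝ))
  refine squeeze_zero' (Eventually.of_forall fun b => abs_nonneg _) ?_ hlim
  filter_upwards [eventually_gt_atTop 0] with b hb
  exact hS.abs_measureReal_stopTime_sub_exp_le hE hI (hδ b) (hδw b) hb (hmpos b) hx
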